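/- Let $d\in\mathbb N$ and $m\ge 0$, and write $\langle x\rangle=(1+|x|^2)^{1/2}$. Let $A\in C^\infty(\mathbb R^d;\mathbb R^d)$, and suppose that for some $\tau\ge 0$ and every multi-index $\beta$ there is a constant $C_\beta$ with $$|\partial_x^\beta A(x)|\le C_\beta\langle x\rangle^{\tau}\qquad(x\in\mathbb R^d).$$ For $F:\mathbb R^d\times\mathbb R^d\to\mathbb C$, say that the oscillatory integral of $F$ exists and equals $I\in\mathbb C$, written $I=\text{Os-}\!\iint F(\xi,y)\,dy\,d\xi$, if for every $\chi\in\mathcal S(\mathbb R^d\times\mathbb R^d)$ with $\chi(0,0)=1$ the function $\chi(\varepsilon\xi,\varepsilon y)F(\xi,y)$ is integrable on $\mathbb R^d\times\mathbb R^d$ for every $\varepsilon>0$ and $$\lim_{\varepsilon\to0+}\iint_{\mathbb R^d\times\mathbb R^d}\chi(\varepsilon\xi,\varepsilon y)F(\xi,y)\,dy\,d\xi=I .$$ Then for every $f\in C_0^\infty(\mathbb R^d)$ and every $x\in\mathbb R^d$ the oscillatory integral defining the Weyl pseudo-differential operator $$(H_A^{(1)}f)(x):=\frac1{(2\pi)^d}\,\text{Os-}\!\iint_{\mathbb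 R^d\times\mathbb R^d}e^{i(x-y)\cdot\xi}\sqrt{\Big(\xi-A\big(\tfrac{x+y}2\big)\Big)^2+m^2}\;f(y)\,dy\,d\xi$$ exists, the oscillatory integral on the right-hand side below exists, and $$(H_A^{(1)}f)(x)=\frac1{(2\pi)^d}\,\text{Os-}\!\iint_{\mathbb R^d\times\mathbb R^d}e^{i(x-y)\cdot(\xi+A(\frac{x+y}2))}\sqrt{\xi^2+m^2}\;f(y)\,dy\,d\xi .$$ -/

import Mathlib

open MeasureTheory Filter Topology
open scoped ContDiff SchwartzMap

noncomputable section

namespace MagneticWeyl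

/-- The space `ℝ^d` with its Euclidean norm. -/
abbrev Space (d : ℕ) : Type := EuclideanSpace ℝ (Fin d)

/-- The mixed partial derivative `∂_{i 0} ⋯ ∂_{i (n-1)} A (x)` of order `n` of a smooth vector
field. Every `∂^β A` with `|β| = n` is of this form. -/
def partialDeriv {d n : ℕ} (i : Fin n → Fin d) (A : Space d → Space d) (x : Space d) : Space d :=
  iteratedFDeriv ℝ n A x (fun j => EuclideanSpace.single (i j) (1 : ℝ))

/-- The regularised integral `∫∫ χ(εξ, εy) F(ξ, y) dy dξ` has the integrand
`χ(εξ, εy) F(ξ, y)`; the point of `ℝ^d × ℝ^d` is written `p = (ξ, y)`. -/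
def regularized {d : ℕ} (χ : 𝓢(Space d × Space d, ℂ)) (F : Space d × Space d → ℂ) (ε : ℝ)
    (p : Space d × Space d) : ℂ :=
  χ (ε • p) * F p

/-- `I` is the oscillatory integral `Os-∫∫ F(ξ, y) dy dξ`: for every cutoff function `χ` in
`𝓢(ℝ^d × ℝ^d)` with `χ(0, 0) = 1`, the functions `χ(εξ, εy) F(ξ, y)`, `ε > 0`, are integrable, and
their integrals tend to `I` as `ε → 0+`. -/
def HasOscIntegral {d : ℕ} (F : Space d × Space d → ℂ) (I : ℂ) : Prop :=
  ∀ χ : 𝓢(Space d × Space d, ℂ), χ 0 = 1 →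
    (∀ ε : ℝ, 0 < ε → Integrable (regularized χ F ε)) ∧
      Tendsto (fun ε : ℝ => ∫ p, regularized χ F ε p) (𝓝[>] 0) (𝓝 I)

/-- The oscillatory integral of `F` exists. -/
def OscIntegrable {d : ℕ} (F : Space d × Space d → ℂ) : Prop :=
  ∃ I : ℂ, HasOscIntegral F I

open Classical in
/-- The value `Os-∫∫ F(ξ, y) dy dξ` (by convention `0` if the oscillatory integral does not
exist). -/
def oscIntegral {d : ℕ} (F : Space d × Space d → ℂ) : ℂ :=
  if h : OscIntegrable F then h.choose else 0

theorem exists_cutoff (d : ℕ) : ∃ χ : 𝓢(Space d × Space d, ℂ), χ 0 = 1 := by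
  let b : ContDiffBump (0 : Space d × Space d) := ⟨1, 2, one_pos, one_lt_two⟩
  have hc : HasCompactSupport (fun p => ((b p : ℝ) : ℂ)) :=
    b.hasCompactSupport.comp_left (g := fun r : ℝ => (r : ℂ)) (by simp)
  have hs : ContDiff ℝ ∞ (fun p => ((b p : ℝ) : ℂ)) :=
    Complex.ofRealCLM.contDiff.comp b.contDiff
  refine ⟨hc.toSchwartzMap hs, ?_⟩
  have h1 : b 0 = 1 := b.one_of_mem_closedBall (by simp [b])
  change ((b 0 : ℝ) : ℂ) = 1
  simp [h1]

theorem HasOscIntegral.unique {d : ℕ} {F : Space d × Space d → ℂ} {I J : ℂ}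
    (hI : HasOscIntegral F I) (hJ : HasOscIntegral F J) : I = J := by
  obtain ⟨χ, hχ⟩ := exists_cutoff d
  exact tendsto_nhds_unique (hI χ hχ).2 (hJ χ hχ).2

theorem HasOscIntegral.oscIntegral_eq {d : ℕ} {F : Space d × Space d → ℂ} {I : ℂ}
    (hI : HasOscIntegral F I) : oscIntegral F = I := by
  have h : OscIntegrable F := ⟨I, hI⟩
  rw [oscIntegral, dif_pos h]
  exact h.choose_spec.unique hI

/-- The integrand `e^{i(x-y)·ξ} √((ξ - A((x+y)/2))² + m²) f(y)`. -/
def weylIntegrand {d : ℕ} (m : ℝ) (A : Space d → Space d) (f : Space d → ℂ) (x : Space d)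
    (p : Space d × Space d) : ℂ :=
  Complex.exp (Complex.I * ((inner ℝ (x - p.2) p.1 : ℝ) : ℂ)) *
    ((Real.sqrt (‖p.1 - A ((1 / 2 : ℝ) • (x + p.2))‖ ^ 2 + m ^ 2) : ℝ) : ℂ) * f p.2

/-- The integrand `e^{i(x-y)·(ξ + A((x+y)/2))} √(ξ² + m²) f(y)`. -/
def shiftedIntegrand {d : ℕ} (m : ℝ) (A : Space d → Space d) (f : Space d → ℂ) (x : Space d)
    (p : Space d × Space d) : ℂ :=
  Complex.exp (Complex.I * ((inner ℝ (x - p.2) (p.1 + A ((1 / 2 : ℝ) • (x + p.2))) : ℝ) : ℂ)) *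
    ((Real.sqrt (‖p.1‖ ^ 2 + m ^ 2) : ℝ) : ℂ) * f p.2

/-- The Weyl pseudo-differential operator `H_A^{(1)}` with mass `m` and vector potential `A`,
applied to `f` and evaluated at `x`. -/
def weylOperator {d : ℕ} (m : ℝ) (A : Space d → Space d) (f : Space d → ℂ) (x : Space d) : ℂ :=
  (1 / (2 * (Real.pi : ℂ)) ^ d) * oscIntegral (weylIntegrand m A f x)

end MagneticWeyl

end

/-!
For each fixed `ξ` the `y`-integral is the Fourier transform of a compactly supported `C^n`
function, whose derivatives of order at most `n` are bounded uniformly in `ξ` and in the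
regularisation parameter `ε ∈ [0, 1]`. It therefore decays like `(1 + |ξ|)^{-n}`, which dominates
the symbol once `n` is large, and `ε → 0` may be taken under the `ξ`-integral.

Put `B(y) = A((x + y)/2)`. The shear `(ξ, y) ↦ (ξ + B(y), y)` preserves volume and carries one
integrand to the other, but it also changes the cutoff to `χ(ε (ξ + B(y)), ε y)`, which is no longer
the dilation of a Schwartz function when `B` is not linear. The uniform bounds nevertheless hold for
it: only `y` in the support of `f` matters, and `ξ` enters through a translation of `χ`, under which
the suprema of its derivatives are invariant.
-/

noncomputable section

namespace MagneticWeyl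

open scoped FourierTransform

section DerivativeBounds

variable {V W G R : Type*} [NormedAddCommGroup V] [NormedSpace ℝ V] [NormedAddCommGroup W]
  [NormedSpace ℝ W] [NormedAddCommGroup G] [NormedSpace ℝ G] [NormedRing R] [NormedAlgebra ℝ R]
  {n : ℕ}

theorem exists_norm_iteratedFDeriv_le_of_isCompact {u : V → G} (hu : ContDiff ℝ n u) {K : Set V}
    (hK : IsCompact K) : ∃ C : ℝ, ∀ q ≤ n, ∀ y ∈ K, ‖iteratedFDeriv ℝ q u y‖ ≤ C := by
  have hcont : Continuous fun y => ∑ q ∈ Finset.range (n + 1), ‖iteratedFDeriv ℝ q u y‖ :=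
    continuous_finsetSum _ fun q hq =>
      (hu.continuous_iteratedFDeriv (mod_cast Finset.mem_range_succ_iff.1 hq)).norm
  obtain ⟨C, hC⟩ := hK.exists_bound_of_continuousOn hcont.continuousOn
  refine ⟨C, fun q hq y hy => ?_⟩
  calc ‖iteratedFDeriv ℝ q u y‖ ≤ ∑ q ∈ Finset.range (n + 1), ‖iteratedFDeriv ℝ q u y‖ :=
        Finset.single_le_sum (f := fun q => ‖iteratedFDeriv ℝ q u y‖) (fun _ _ => norm_nonneg _)
          (Finset.mem_range_succ_iff.2 hq)
    _ ≤ C := (le_abs_self _).trans (hC y hy)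

theorem norm_iteratedFDeriv_mul_le_two_pow_mul {u v : V → R} (hu : ContDiff ℝ n u)
    (hv : ContDiff ℝ n v) {y : V} {C D : ℝ} (hC : ∀ q ≤ n, ‖iteratedFDeriv ℝ q u y‖ ≤ C)
    (hD : ∀ q ≤ n, ‖iteratedFDeriv ℝ q v y‖ ≤ D) :
    ‖iteratedFDeriv ℝ n (fun z => u z * v z) y‖ ≤ 2 ^ n * (C * D) := by
  have hC₀ : 0 ≤ C := (norm_nonneg _).trans (hC 0 n.zero_le)
  calc ‖iteratedFDeriv ℝ n (fun z => u z * v z) y‖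
      ≤ ∑ i ∈ Finset.range (n + 1), (n.choose i : ℝ) * ‖iteratedFDeriv ℝ i u y‖ *
          ‖iteratedFDeriv ℝ (n - i) v y‖ := norm_iteratedFDeriv_mul_le hu hv y le_rfl
    _ ≤ ∑ i ∈ Finset.range (n + 1), (n.choose i : ℝ) * (C * D) := by
        refine Finset.sum_le_sum fun i hi => ?_
        rw [mul_assoc]
        gcongr
        · exact hC i (Finset.mem_range_succ_iff.1 hi)
        · exact hD (n - i) (n.sub_le i)
    _ = 2 ^ n * (C * D) := by
        rw [← Finset.sum_mul]
        exact_mod_cast congrArg (fun k : ℕ => (k : ℝ) * (C * D)) (Nat.sum_range_choose n)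

theorem exists_norm_iteratedFDeriv_comp_add_smul_le {Φ : W → G} (hΦ : ContDiff ℝ n Φ) {S : ℝ}
    (hS : ∀ q ≤ n, ∀ z, ‖iteratedFDeriv ℝ q Φ z‖ ≤ S) {h : V → W} (hh : ContDiff ℝ n h)
    {K : Set V} (hK : IsCompact K) :
    ∃ C : ℝ, ∀ (c : W), ∀ ε ∈ Set.Icc (0 : ℝ) 1, ∀ q ≤ n, ∀ y ∈ K,
      ‖iteratedFDeriv ℝ q (fun z => Φ (c + ε • h z)) y‖ ≤ C := by
  obtain ⟨D, hD⟩ := exists_norm_iteratedFDeriv_le_of_isCompact hh hK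
  have hS₀ : 0 ≤ S := (norm_nonneg _).trans (hS 0 n.zero_le 0)
  refine ⟨n.factorial * S * (max D 1) ^ n, fun c ε hε q hq y hy => ?_⟩
  have htrans : ContDiff ℝ n fun w => Φ (c + w) := hΦ.comp (contDiff_const.add contDiff_id)
  have hinner : ∀ j, 1 ≤ j → j ≤ q →
      ‖iteratedFDeriv ℝ j (fun z => ε • h z) y‖ ≤ (max D 1) ^ j := fun j hj₁ hj => by
    rw [iteratedFDeriv_const_smul_apply' (hh.contDiffAt.of_le (mod_cast hj.trans hq)), norm_smul,
      Real.norm_of_nonneg hε.1]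
    calc ε * ‖iteratedFDeriv ℝ j h y‖ ≤ 1 * max D 1 := by
          gcongr
          · exact hε.2
          · exact (hD j (hj.trans hq) y hy).trans (le_max_left _ _)
      _ ≤ (max D 1) ^ j := by
          rw [one_mul]
          exact le_self_pow₀ (le_max_right _ _) (by lia)
  calc ‖iteratedFDeriv ℝ q ((fun w => Φ (c + w)) ∘ fun z => ε • h z) y‖
      ≤ q.factorial * S * (max D 1) ^ q := by
        refine norm_iteratedFDeriv_comp_le htrans (hh.const_smul ε) (mod_cast hq) y
          (fun j hj => ?_) hinner
        rw [iteratedFDeriv_comp_add_left]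
        exact hS j (hj.trans hq) _
    _ ≤ n.factorial * S * (max D 1) ^ n := by
        gcongr
        exact le_max_right _ _

theorem exists_norm_iteratedFDeriv_schwartz_le (χ : 𝓢(W, G)) (n : ℕ) :
    ∃ S : ℝ, ∀ q ≤ n, ∀ z, ‖iteratedFDeriv ℝ q χ z‖ ≤ S :=
  ⟨_, fun q hq z => by
    simpa using SchwartzMap.one_add_le_sup_seminorm_apply (𝕜 := ℝ) (m := (0, n)) le_rfl hq χ z⟩

end DerivativeBounds

section FourierDecay

variable {V E : Type*} [NormedAddCommGroup V] [InnerProductSpace ℝ V] [FiniteDimensional ℝ V]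
  [MeasurableSpace V] [BorelSpace V] [NormedAddCommGroup E] [NormedSpace ℂ E] {n : ℕ}

theorem norm_pow_mul_norm_fourier_le {u : V → E} (hu : ContDiff ℝ n u)
    (hint : ∀ q ≤ n, Integrable (iteratedFDeriv ℝ q u)) (w : V) :
    ‖w‖ ^ n * ‖𝓕 u w‖ ≤ 2 ^ n * ∑ q ∈ Finset.range (n + 1), ∫ y, ‖iteratedFDeriv ℝ q u y‖ := by
  have h := Real.pow_mul_norm_iteratedFDeriv_fourier_le (K := 0) (N := n) hu
    (fun k j hk hj => by
      obtain rfl : k = 0 := by simpa using hk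
      simpa using (hint j (by exact_mod_cast hj)).norm) (k := 0) (n := n) le_rfl le_rfl w
  simpa [Finset.sum_product] using h

theorem one_add_norm_pow_mul_norm_fourier_le {u : V → E} (hu : ContDiff ℝ n u)
    (hint : ∀ q ≤ n, Integrable (iteratedFDeriv ℝ q u)) (w : V) :
    (1 + ‖w‖) ^ n * ‖𝓕 u w‖ ≤
      2 ^ (n - 1) * (1 + 2 ^ n) * ∑ q ∈ Finset.range (n + 1), ∫ y, ‖iteratedFDeriv ℝ q u y‖ := by
  set S := ∑ q ∈ Finset.range (n + 1), ∫ y, ‖iteratedFDeriv ℝ q u y‖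
  have hzero : ‖𝓕 u w‖ ≤ S :=
    calc ‖𝓕 u w‖ ≤ ∫ y, ‖iteratedFDeriv ℝ 0 u y‖ := by
          simpa using norm_pow_mul_norm_fourier_le (n := 0) (hu.of_le (mod_cast n.zero_le))
            (fun q hq => hint q (hq.trans n.zero_le)) w
      _ ≤ S := Finset.single_le_sum (f := fun q => ∫ y, ‖iteratedFDeriv ℝ q u y‖)
          (fun _ _ => integral_nonneg fun _ => norm_nonneg _) (by simp)
  calc (1 + ‖w‖) ^ n * ‖𝓕 u w‖ ≤ 2 ^ (n - 1) * (1 ^ n + ‖w‖ ^ n) * ‖𝓕 u w‖ := by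
        gcongr
        exact add_pow_le zero_le_one (norm_nonneg _) n
    _ = 2 ^ (n - 1) * (‖𝓕 u w‖ + ‖w‖ ^ n * ‖𝓕 u w‖) := by ring
    _ ≤ 2 ^ (n - 1) * (S + 2 ^ n * S) := by
        gcongr 2 ^ (n - 1) * (?_ + ?_)
        exact norm_pow_mul_norm_fourier_le hu hint w
    _ = 2 ^ (n - 1) * (1 + 2 ^ n) * S := by ring

theorem exists_one_add_norm_pow_mul_norm_fourier_le {K : Set V} (hK : IsCompact K) (C : ℝ)
    (n : ℕ) : ∃ M : ℝ, ∀ u : V → E, ContDiff ℝ n u → tsupport u ⊆ K →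
      (∀ q ≤ n, ∀ y ∈ K, ‖iteratedFDeriv ℝ q u y‖ ≤ C) →
        ∀ w, (1 + ‖w‖) ^ n * ‖𝓕 u w‖ ≤ M := by
  refine ⟨2 ^ (n - 1) * (1 + 2 ^ n) * ∑ _q ∈ Finset.range (n + 1), C * volume.real K,
    fun u hu hsupp hC w => ?_⟩
  have hint : ∀ q ≤ n, Integrable (iteratedFDeriv ℝ q u) := fun q hq =>
    (hu.continuous_iteratedFDeriv (mod_cast hq)).integrable_of_hasCompactSupport
      (.iteratedFDeriv (hK.of_isClosed_subset (isClosed_tsupport u) hsupp) q)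
  refine (one_add_norm_pow_mul_norm_fourier_le hu hint w).trans ?_
  gcongr with q hq
  have hzero : ∀ y ∉ K, ‖iteratedFDeriv ℝ q u y‖ = 0 := fun y hy =>
    norm_eq_zero.2 <| image_eq_zero_of_notMem_tsupport fun h =>
      hy (hsupp (tsupport_iteratedFDeriv_subset q h))
  rw [← setIntegral_eq_integral_of_forall_compl_eq_zero hzero]
  refine (Real.le_norm_self _).trans
    (norm_setIntegral_le_of_norm_le_const hK.measure_lt_top fun y hy => ?_)
  rw [norm_norm]
  exact hC q (Finset.mem_range_succ_iff.1 hq) y hy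

end FourierDecay

section CutoffAmplitude

variable {V : Type*} [NormedAddCommGroup V] [InnerProductSpace ℝ V] {χ : 𝓢(V × V, ℂ)} {B : V → V}
  {g : V → ℂ} {n : ℕ}

/-- The amplitude `y ↦ χ(ε(ξ + B(y)), εy) g(y)` that remains at frequency `ξ` once the shear
`(ξ, y) ↦ (ξ + B(y), y)` has been applied to the cutoff `χ(εξ, εy)`. -/
def cutoffAmplitude (χ : 𝓢(V × V, ℂ)) (B : V → V) (g : V → ℂ) (ε : ℝ) (ξ y : V) : ℂ :=
  χ (ε • (ξ + B y, y)) * g y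

theorem tsupport_cutoffAmplitude_subset (ε : ℝ) (ξ : V) :
    tsupport (cutoffAmplitude χ B g ε ξ) ⊆ tsupport g :=
  tsupport_mul_subset_right

theorem contDiff_cutoffAmplitude (hB : ContDiff ℝ n B) (hg : ContDiff ℝ n g) (ε : ℝ) (ξ : V) :
    ContDiff ℝ n (cutoffAmplitude χ B g ε ξ) :=
  ((χ.smooth n).comp (((contDiff_const.add hB).prodMk contDiff_id).const_smul ε)).mul hg

/-- The bound is uniform in `ξ` since `ξ` only translates the argument of `χ`. -/
theorem exists_norm_iteratedFDeriv_cutoffAmplitude_le (χ : 𝓢(V × V, ℂ)) (hB : ContDiff ℝ n B)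
    (hg : ContDiff ℝ n g) (hgc : HasCompactSupport g) :
    ∃ C : ℝ, ∀ ε ∈ Set.Icc (0 : ℝ) 1, ∀ (ξ : V), ∀ q ≤ n, ∀ y ∈ tsupport g,
      ‖iteratedFDeriv ℝ q (cutoffAmplitude χ B g ε ξ) y‖ ≤ C := by
  obtain ⟨S, hS⟩ := exists_norm_iteratedFDeriv_schwartz_le χ n
  obtain ⟨D, hD⟩ := exists_norm_iteratedFDeriv_comp_add_smul_le (χ.smooth n) hS
    (hB.prodMk contDiff_id) hgc
  obtain ⟨M, hM⟩ := exists_norm_iteratedFDeriv_le_of_isCompact hg hgc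
  refine ⟨2 ^ n * (D * M), fun ε hε ξ q hq y hy => ?_⟩
  have hq' : (q : WithTop ℕ∞) ≤ n := mod_cast hq
  have hsplit : ∀ z, ε • (ξ + B z, z) = (ε • ξ, 0) + ε • (B z, z) := by simp
  have hcut : ∀ j ≤ q, ‖iteratedFDeriv ℝ j (fun z => χ (ε • (ξ + B z, z))) y‖ ≤ D := fun j hj => by
    simp only [hsplit]
    exact hD _ ε hε j (hj.trans hq) y hy
  have hcontDiff : ContDiff ℝ q fun z => χ (ε • (ξ + B z, z)) :=
    ((χ.smooth n).comp (((contDiff_const.add hB).prodMk contDiff_id).const_smul ε)).of_le hq'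
  have hD₀ : 0 ≤ D := (norm_nonneg _).trans (hcut 0 q.zero_le)
  have hM₀ : 0 ≤ M := (norm_nonneg _).trans (hM 0 n.zero_le y hy)
  calc ‖iteratedFDeriv ℝ q (cutoffAmplitude χ B g ε ξ) y‖ ≤ 2 ^ q * (D * M) :=
        norm_iteratedFDeriv_mul_le_two_pow_mul hcontDiff (hg.of_le hq') hcut
          fun j hj => hM j (hj.trans hq) y hy
    _ ≤ 2 ^ n * (D * M) := by
        gcongr
        exact one_le_two

theorem one_add_norm_le_two_pi_mul (ξ : V) :
    1 + ‖ξ‖ ≤ 2 * Real.pi * (1 + ‖(2 * Real.pi)⁻¹ • ξ‖) := by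
  rw [norm_smul, norm_inv, Real.norm_of_nonneg Real.two_pi_pos.le, mul_add,
    mul_inv_cancel_left₀ Real.two_pi_pos.ne']
  linarith [Real.pi_gt_three]

variable [FiniteDimensional ℝ V] [MeasurableSpace V] [BorelSpace V]

theorem exists_one_add_norm_pow_mul_norm_fourier_cutoffAmplitude_le (χ : 𝓢(V × V, ℂ))
    (hB : ContDiff ℝ n B) (hg : ContDiff ℝ n g) (hgc : HasCompactSupport g) :
    ∃ M : ℝ, ∀ ε ∈ Set.Icc (0 : ℝ) 1, ∀ ξ w : V,
      (1 + ‖w‖) ^ n * ‖𝓕 (cutoffAmplitude χ B g ε ξ) w‖ ≤ M := by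
  obtain ⟨C, hC⟩ := exists_norm_iteratedFDeriv_cutoffAmplitude_le χ hB hg hgc
  obtain ⟨M, hM⟩ := exists_one_add_norm_pow_mul_norm_fourier_le (E := ℂ) hgc C n
  exact ⟨M, fun ε hε ξ => hM _ (contDiff_cutoffAmplitude hB hg ε ξ)
    (tsupport_cutoffAmplitude_subset ε ξ) (hC ε hε ξ)⟩

theorem tendsto_fourier_cutoffAmplitude (hχ : χ 0 = 1) (hB : Continuous B) (hg : Continuous g)
    (hgc : HasCompactSupport g) (ξ w : V) :
    Tendsto (fun ε : ℝ => 𝓕 (cutoffAmplitude χ B g ε ξ) w) (𝓝 0) (𝓝 (𝓕 g w)) := by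
  obtain ⟨S, hS⟩ := exists_norm_iteratedFDeriv_schwartz_le χ 0
  have hχS : ∀ z, ‖χ z‖ ≤ S := fun z => by simpa using hS 0 le_rfl z
  have hχc : Continuous χ := χ.continuous
  simp only [Real.fourier_eq]
  refine tendsto_integral_filter_of_dominated_convergence (fun y => S * ‖g y‖) ?_ ?_
    ((hg.integrable_of_hasCompactSupport hgc).norm.const_mul S) ?_
  · refine Eventually.of_forall fun ε => Continuous.aestronglyMeasurable ?_
    unfold cutoffAmplitude
    fun_prop
  · refine Eventually.of_forall fun ε => Eventually.of_forall fun y => ?_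
    rw [Circle.norm_smul, cutoffAmplitude, norm_mul]
    gcongr
    exact hχS _
  · refine Eventually.of_forall fun y => Tendsto.const_smul ?_ _
    have hlim : Tendsto (fun ε : ℝ => χ (ε • (ξ + B y, y)) * g y) (𝓝 0)
        (𝓝 (χ ((0 : ℝ) • (ξ + B y, y)) * g y)) :=
      Continuous.tendsto (by fun_prop) 0
    rwa [zero_smul, hχ, one_mul] at hlim

theorem measurable_fourier_cutoffAmplitude (χ : 𝓢(V × V, ℂ)) (hB : Measurable B)
    (hg : Measurable g) (ε c : ℝ) :
    Measurable fun ξ => 𝓕 (cutoffAmplitude χ B g ε ξ) (c • ξ) := by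
  have hχ : Measurable χ := χ.continuous.measurable
  have huncurry : StronglyMeasurable fun p : V × V =>
      Complex.exp (↑(-2 * Real.pi * inner ℝ p.2 (c • p.1)) * Complex.I) •
        (χ (ε • (p.1 + B p.2, p.2)) * g p.2) :=
    Measurable.stronglyMeasurable (by fun_prop)
  simp only [Real.fourier_eq', cutoffAmplitude]
  exact huncurry.integral_prod_right'.measurable

theorem exists_norm_mul_fourier_cutoffAmplitude_le {k r : ℕ} {b : V → ℂ} {C : ℝ}
    (hbC : ∀ ξ, ‖b ξ‖ ≤ C * (1 + ‖ξ‖) ^ k) (χ : 𝓢(V × V, ℂ)) (hB : ContDiff ℝ (k + r : ℕ) B)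
    (hg : ContDiff ℝ (k + r : ℕ) g) (hgc : HasCompactSupport g) :
    ∃ M : ℝ, ∀ ε ∈ Set.Icc (0 : ℝ) 1, ∀ ξ : V,
      ‖b ξ * 𝓕 (cutoffAmplitude χ B g ε ξ) ((2 * Real.pi)⁻¹ • ξ)‖ ≤
        M * (1 + ‖(2 * Real.pi)⁻¹ • ξ‖) ^ (-(r : ℝ)) := by
  obtain ⟨M, hM⟩ := exists_one_add_norm_pow_mul_norm_fourier_cutoffAmplitude_le χ hB hg hgc
  have hC₀ : 0 ≤ C := by simpa using (norm_nonneg _).trans (hbC 0)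
  refine ⟨C * (2 * Real.pi) ^ k * M, fun ε hε ξ => ?_⟩
  have hξ := one_add_norm_le_two_pi_mul ξ
  set w := (2 * Real.pi)⁻¹ • ξ
  rw [norm_mul, Real.rpow_neg (by positivity), Real.rpow_natCast, ← div_eq_mul_inv,
    le_div_iff₀ (by positivity)]
  set J := ‖𝓕 (cutoffAmplitude χ B g ε ξ) w‖
  calc ‖b ξ‖ * J * (1 + ‖w‖) ^ r
      ≤ C * (2 * Real.pi * (1 + ‖w‖)) ^ k * J * (1 + ‖w‖) ^ r := by
        gcongr
        exact (hbC ξ).trans (by gcongr)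
    _ = C * (2 * Real.pi) ^ k * ((1 + ‖w‖) ^ (k + r) * J) := by
        rw [mul_pow]
        ring
    _ ≤ C * (2 * Real.pi) ^ k * M := by
        gcongr
        exact hM ε hε ξ w

theorem tendsto_integral_mul_fourier_cutoffAmplitude {k : ℕ} {b : V → ℂ} (hb : Measurable b)
    {C : ℝ} (hbC : ∀ ξ, ‖b ξ‖ ≤ C * (1 + ‖ξ‖) ^ k) (hχ : χ 0 = 1)
    (hB : ContDiff ℝ (k + (Module.finrank ℝ V + 1) : ℕ) B)
    (hg : ContDiff ℝ (k + (Module.finrank ℝ V + 1) : ℕ) g) (hgc : HasCompactSupport g) :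
    Tendsto (fun ε : ℝ => ∫ ξ, b ξ * 𝓕 (cutoffAmplitude χ B g ε ξ) ((2 * Real.pi)⁻¹ • ξ))
      (𝓝[>] 0) (𝓝 (∫ ξ, b ξ * 𝓕 g ((2 * Real.pi)⁻¹ • ξ))) := by
  obtain ⟨M, hM⟩ := exists_norm_mul_fourier_cutoffAmplitude_le hbC χ hB hg hgc
  have hdom : Integrable fun ξ : V =>
      M * (1 + ‖(2 * Real.pi)⁻¹ • ξ‖) ^ (-((Module.finrank ℝ V + 1 : ℕ) : ℝ)) :=
    ((integrable_one_add_norm (by simp)).comp_smul (inv_ne_zero Real.two_pi_pos.ne')).const_mul M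
  refine tendsto_integral_filter_of_dominated_convergence _ ?_ ?_ hdom ?_
  · exact Eventually.of_forall fun ε => (hb.mul (measurable_fourier_cutoffAmplitude χ
      hB.continuous.measurable hg.continuous.measurable ε _)).aestronglyMeasurable
  · filter_upwards [Ioc_mem_nhdsGT zero_lt_one] with ε hε
    exact Eventually.of_forall (hM ε (Set.Ioc_subset_Icc_self hε))
  · exact Eventually.of_forall fun ξ => ((tendsto_fourier_cutoffAmplitude hχ hB.continuous
      hg.continuous hgc ξ _).mono_left nhdsWithin_le_nhds).const_mul _

theorem integral_cutoff_mul_eq_integral_mul_fourier {b : V → ℂ} {ε : ℝ}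
    (hint : Integrable fun p : V × V => χ (ε • (p.1 + B p.2, p.2)) *
      (Complex.exp (-Complex.I * (inner ℝ p.2 p.1 : ℝ)) * b p.1 * g p.2)) :
    ∫ p : V × V, χ (ε • (p.1 + B p.2, p.2)) *
        (Complex.exp (-Complex.I * (inner ℝ p.2 p.1 : ℝ)) * b p.1 * g p.2) =
      ∫ ξ, b ξ * 𝓕 (cutoffAmplitude χ B g ε ξ) ((2 * Real.pi)⁻¹ • ξ) := by
  refine (integral_prod _ hint).trans (integral_congr_ae (Eventually.of_forall fun ξ => ?_))
  simp only [Real.fourier_eq', ← integral_const_mul, cutoffAmplitude]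
  refine integral_congr_ae (Eventually.of_forall fun y => ?_)
  have hphase : ((-2 * Real.pi * inner ℝ y ((2 * Real.pi)⁻¹ • ξ) : ℝ) : ℂ) * Complex.I =
      -Complex.I * (inner ℝ y ξ : ℝ) := by
    rw [inner_smul_right]
    push_cast
    field_simp
  simp only [hphase, smul_eq_mul]
  ring

end CutoffAmplitude

section Shear

variable {X G : Type*} [MeasurableSpace X] [MeasurableSpace G] [AddGroup G] [MeasurableAdd₂ G]
  [MeasurableSub₂ G] {B : X → G}

/-- The change of variables `(ξ, y) ↦ (ξ + B(y), y)`. -/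
def shear (hB : Measurable B) : G × X ≃ᵐ G × X where
  toFun p := (p.1 + B p.2, p.2)
  invFun p := (p.1 - B p.2, p.2)
  left_inv p := by simp
  right_inv p := by simp
  measurable_toFun := (measurable_fst.add (hB.comp measurable_snd)).prodMk measurable_snd
  measurable_invFun := (measurable_fst.sub (hB.comp measurable_snd)).prodMk measurable_snd

theorem measurePreserving_shear (hB : Measurable B) (μ : Measure G) [SFinite μ]
    [μ.IsAddRightInvariant] (ν : Measure X) [SFinite ν] :
    MeasurePreserving (shear hB) (μ.prod ν) (μ.prod ν) := by
  have hskew : MeasurePreserving (fun p : X × G => (p.1, p.2 + B p.1)) (ν.prod μ) (ν.prod μ) :=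
    (MeasurePreserving.id ν).skew_product (g := fun y ξ => ξ + B y) (by fun_prop)
      (Eventually.of_forall fun y => map_add_right_eq_self μ (B y))
  exact (Measure.measurePreserving_swap.comp hskew).comp Measure.measurePreserving_swap

end Shear

section OscillatoryIntegral

variable {d k : ℕ}

theorem integrable_regularized {F : Space d × Space d → ℂ} (hF : AEStronglyMeasurable F) {C : ℝ}
    (hFC : ∀ p, ‖F p‖ ≤ C * (1 + ‖p‖) ^ k) (χ : 𝓢(Space d × Space d, ℂ)) {ε : ℝ} (hε : 0 < ε) :
    Integrable (regularized χ F ε) := by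
  let dilation : (Space d × Space d) ≃L[ℝ] (Space d × Space d) :=
    ContinuousLinearEquiv.smulLeft (Units.mk0 ε hε.ne')
  let ψ : 𝓢(Space d × Space d, ℂ) := SchwartzMap.compCLMOfContinuousLinearEquiv ℝ dilation χ
  have hψ : ∀ p, ψ p = χ (ε • p) := fun _ => rfl
  have : (volume : Measure (Space d × Space d)).IsAddHaarMeasure :=
    Measure.prod.instIsAddHaarMeasure _ _
  have hC₀ : 0 ≤ C := by simpa using (norm_nonneg _).trans (hFC 0)
  have hdom : Integrable fun p => C * 2 ^ (k - 1) * (‖p‖ ^ 0 * ‖ψ p‖ + ‖p‖ ^ k * ‖ψ p‖) :=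
    ((ψ.integrable_pow_mul volume 0).add (ψ.integrable_pow_mul volume k)).const_mul _
  refine hdom.mono' (ψ.continuous.aestronglyMeasurable.mul hF) (Eventually.of_forall fun p => ?_)
  calc ‖regularized χ F ε p‖ = ‖ψ p‖ * ‖F p‖ := by rw [regularized, norm_mul, hψ]
    _ ≤ ‖ψ p‖ * (C * (2 ^ (k - 1) * (1 ^ k + ‖p‖ ^ k))) := by
        gcongr
        refine (hFC p).trans ?_
        gcongr
        exact add_pow_le zero_le_one (norm_nonneg p) k
    _ = C * 2 ^ (k - 1) * (‖p‖ ^ 0 * ‖ψ p‖ + ‖p‖ ^ k * ‖ψ p‖) := by ring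

theorem hasOscIntegral_of_comp_shear {F : Space d × Space d → ℂ} (hF : AEStronglyMeasurable F)
    {C : ℝ} (hFC : ∀ p, ‖F p‖ ≤ C * (1 + ‖p‖) ^ k) {B : Space d → Space d}
    (hB : ContDiff ℝ (k + (d + 1) : ℕ) B) {b : Space d → ℂ} (hb : Measurable b) {C' : ℝ}
    (hbC : ∀ ξ, ‖b ξ‖ ≤ C' * (1 + ‖ξ‖) ^ k) {g : Space d → ℂ}
    (hg : ContDiff ℝ (k + (d + 1) : ℕ) g) (hgc : HasCompactSupport g)
    (hFB : ∀ ξ y, F (ξ + B y, y) = Complex.exp (-Complex.I * (inner ℝ y ξ : ℝ)) * b ξ * g y) :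
    HasOscIntegral F (∫ ξ, b ξ * 𝓕 g ((2 * Real.pi)⁻¹ • ξ)) := by
  intro χ hχ
  have hint := fun ε (hε : 0 < ε) => integrable_regularized hF hFC χ hε
  refine ⟨hint, ?_⟩
  have hshear := measurePreserving_shear hB.continuous.measurable
    (volume : Measure (Space d)) (volume : Measure (Space d))
  have hcomp : ∀ ε p, regularized χ F ε (shear hB.continuous.measurable p) =
      χ (ε • (p.1 + B p.2, p.2)) *
        (Complex.exp (-Complex.I * (inner ℝ p.2 p.1 : ℝ)) * b p.1 * g p.2) :=
    fun ε p => congrArg (χ (ε • (p.1 + B p.2, p.2)) * ·) (hFB p.1 p.2)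
  have heq : ∀ ε, 0 < ε → ∫ p, regularized χ F ε p =
      ∫ ξ, b ξ * 𝓕 (cutoffAmplitude χ B g ε ξ) ((2 * Real.pi)⁻¹ • ξ) := fun ε hε => by
    rw [← integral_cutoff_mul_eq_integral_mul_fourier]
    · simp only [← hcomp]
      exact (hshear.integral_comp' _).symm
    · simp only [← hcomp]
      exact hshear.integrable_comp_of_integrable (hint ε hε)
  refine (tendsto_integral_mul_fourier_cutoffAmplitude hb hbC hχ (by simpa using hB)
    (by simpa using hg) hgc).congr' ?_
  filter_upwards [self_mem_nhdsWithin] with ε hε using (heq ε hε).symm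

theorem exists_norm_symbol_sub_mul_le {V : Type*} [NormedAddCommGroup V] {a : V → ℂ} {C : ℝ}
    (haC : ∀ ξ, ‖a ξ‖ ≤ C * (1 + ‖ξ‖) ^ k) {B : V → V} (hB : Continuous B) {f : V → ℂ}
    (hf : Continuous f) (hfc : HasCompactSupport f) :
    ∃ C' : ℝ, ∀ p : V × V, ‖a (p.1 - B p.2) * f p.2‖ ≤ C' * (1 + ‖p‖) ^ k := by
  obtain ⟨M, hM⟩ := (hfc.smul_left (f := fun y => (1 + ‖B y‖) ^ k)).exists_bound_of_continuous
    (((continuous_const.add hB.norm).pow k).smul hf)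
  have hC₀ : 0 ≤ C := by simpa using (norm_nonneg _).trans (haC 0)
  refine ⟨C * M, fun ⟨ξ, y⟩ => ?_⟩
  have hMy : (1 + ‖B y‖) ^ k * ‖f y‖ ≤ M := by
    have h := hM y
    rwa [Pi.smul_apply', norm_smul, Real.norm_of_nonneg (by positivity)] at h
  have hsub : 1 + ‖ξ - B y‖ ≤ (1 + ‖(ξ, y)‖) * (1 + ‖B y‖) := by
    nlinarith [norm_sub_le ξ (B y), norm_fst_le (ξ, y), norm_nonneg (ξ, y), norm_nonneg (B y),
      mul_nonneg (norm_nonneg (ξ, y)) (norm_nonneg (B y))]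
  calc ‖a (ξ - B y) * f y‖ ≤ C * ((1 + ‖(ξ, y)‖) * (1 + ‖B y‖)) ^ k * ‖f y‖ := by
        rw [norm_mul]
        gcongr
        exact (haC _).trans (by gcongr)
    _ = C * (1 + ‖(ξ, y)‖) ^ k * ((1 + ‖B y‖) ^ k * ‖f y‖) := by rw [mul_pow]; ring
    _ ≤ C * (1 + ‖(ξ, y)‖) ^ k * M := by gcongr
    _ = C * M * (1 + ‖(ξ, y)‖) ^ k := by ring

end OscillatoryIntegral

section SymbolIntegrands

variable {d k : ℕ} {a : Space d → ℂ} {B : Space d → Space d} {f : Space d → ℂ}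

/-- The integrand `e^{i(x-y)·ξ} a(ξ - B(y)) f(y)`, which is `weylIntegrand` for a general symbol `a`
when `B(y) = A((x+y)/2)`. -/
def symbolWeylIntegrand (a : Space d → ℂ) (B : Space d → Space d) (f : Space d → ℂ) (x : Space d)
    (p : Space d × Space d) : ℂ :=
  Complex.exp (Complex.I * (inner ℝ (x - p.2) p.1 : ℝ)) * a (p.1 - B p.2) * f p.2

/-- The integrand `e^{i(x-y)·(ξ + B(y))} a(ξ) f(y)`, which is `shiftedIntegrand` for a general
symbol `a` when `B(y) = A((x+y)/2)`. -/
def symbolShiftedIntegrand (a : Space d → ℂ) (B : Space d → Space d) (f : Space d → ℂ)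
    (x : Space d) (p : Space d × Space d) : ℂ :=
  Complex.exp (Complex.I * (inner ℝ (x - p.2) (p.1 + B p.2) : ℝ)) * a p.1 * f p.2

/-- The amplitude `y ↦ e^{i(x-y)·B(y)} f(y)`, whose Fourier transform is the `y`-integral of both
integrands after the shear. -/
def gaugedAmplitude (B : Space d → Space d) (f : Space d → ℂ) (x y : Space d) : ℂ :=
  Complex.exp (Complex.I * (inner ℝ (x - y) (B y) : ℝ)) * f y

theorem contDiff_gaugedAmplitude {n : WithTop ℕ∞} (hB : ContDiff ℝ n B) (hf : ContDiff ℝ n f)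
    (x : Space d) : ContDiff ℝ n (gaugedAmplitude B f x) :=
  (Complex.contDiff_exp.comp (contDiff_const.mul (Complex.ofRealCLM.contDiff.comp
    ((contDiff_const.sub contDiff_id).inner ℝ hB)))).mul hf

theorem symbolShiftedIntegrand_eq (a : Space d → ℂ) (B : Space d → Space d) (f : Space d → ℂ)
    (x ξ y : Space d) :
    symbolShiftedIntegrand a B f x (ξ, y) = Complex.exp (-Complex.I * (inner ℝ y ξ : ℝ)) *
      (Complex.exp (Complex.I * (inner ℝ x ξ : ℝ)) * a ξ) * gaugedAmplitude B f x y := by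
  have hphase : Complex.I * (inner ℝ (x - y) (ξ + B y) : ℝ) = -Complex.I * (inner ℝ y ξ : ℝ) +
      Complex.I * (inner ℝ x ξ : ℝ) + Complex.I * (inner ℝ (x - y) (B y) : ℝ) := by
    rw [inner_add_right, inner_sub_left x y ξ]
    push_cast
    ring
  rw [symbolShiftedIntegrand, gaugedAmplitude, hphase, Complex.exp_add, Complex.exp_add]
  ring

theorem symbolWeylIntegrand_shear (a : Space d → ℂ) (B : Space d → Space d) (f : Space d → ℂ)
    (x ξ y : Space d) :
    symbolWeylIntegrand a B f x (ξ + B y, y) = symbolShiftedIntegrand a B f x (ξ, y) := by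
  simp only [symbolWeylIntegrand, symbolShiftedIntegrand, add_sub_cancel_right]

theorem norm_exp_I_mul_ofReal_mul (t : ℝ) (z : ℂ) : ‖Complex.exp (Complex.I * t) * z‖ = ‖z‖ := by
  rw [norm_mul, Complex.norm_exp_I_mul_ofReal, one_mul]

theorem exists_hasOscIntegral_symbolIntegrands (ha : Measurable a) {C : ℝ}
    (haC : ∀ ξ, ‖a ξ‖ ≤ C * (1 + ‖ξ‖) ^ k) (hB : ContDiff ℝ (k + (d + 1) : ℕ) B)
    (hf : ContDiff ℝ (k + (d + 1) : ℕ) f) (hfc : HasCompactSupport f) (x : Space d) :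
    ∃ I, HasOscIntegral (symbolWeylIntegrand a B f x) I ∧
      HasOscIntegral (symbolShiftedIntegrand a B f x) I := by
  have hBm : Measurable B := hB.continuous.measurable
  have hfm : Measurable f := hf.continuous.measurable
  have hb : Measurable fun ξ => Complex.exp (Complex.I * (inner ℝ x ξ : ℝ)) * a ξ := by fun_prop
  have hbC : ∀ ξ, ‖Complex.exp (Complex.I * (inner ℝ x ξ : ℝ)) * a ξ‖ ≤ C * (1 + ‖ξ‖) ^ k := by
    simpa only [norm_exp_I_mul_ofReal_mul] using haC
  have hg := contDiff_gaugedAmplitude hB hf x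
  have hgc : HasCompactSupport (gaugedAmplitude B f x) := hfc.mul_left
  obtain ⟨Cw, hw⟩ := exists_norm_symbol_sub_mul_le haC hB.continuous hf.continuous hfc
  obtain ⟨Cs, hs⟩ := exists_norm_symbol_sub_mul_le haC (B := 0) continuous_zero hf.continuous hfc
  refine ⟨_, hasOscIntegral_of_comp_shear (C := Cw) ?_ ?_ hB hb hbC hg hgc fun ξ y => ?_,
    hasOscIntegral_of_comp_shear (C := Cs) ?_ ?_ (contDiff_zero_fun (𝕜 := ℝ)) hb hbC hg hgc
      fun ξ y => ?_⟩
  · unfold symbolWeylIntegrand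
    exact Measurable.aestronglyMeasurable (by fun_prop)
  · simpa only [symbolWeylIntegrand, mul_assoc, norm_exp_I_mul_ofReal_mul] using hw
  · rw [symbolWeylIntegrand_shear, symbolShiftedIntegrand_eq]
  · unfold symbolShiftedIntegrand
    exact Measurable.aestronglyMeasurable (by fun_prop)
  · simpa only [symbolShiftedIntegrand, mul_assoc, norm_exp_I_mul_ofReal_mul, Pi.zero_apply,
      sub_zero] using hs
  · rw [add_zero, symbolShiftedIntegrand_eq]

end SymbolIntegrands

theorem norm_sqrt_norm_sq_add_sq_le {V : Type*} [NormedAddCommGroup V] (m : ℝ) (v : V) :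
    ‖((Real.sqrt (‖v‖ ^ 2 + m ^ 2) : ℝ) : ℂ)‖ ≤ (1 + |m|) * (1 + ‖v‖) := by
  rw [Complex.norm_of_nonneg (Real.sqrt_nonneg _), Real.sqrt_le_left (by positivity), ← sq_abs m]
  nlinarith [norm_nonneg v, abs_nonneg m, mul_nonneg (norm_nonneg v) (abs_nonneg m)]

end MagneticWeyl

end

theorem proposition2p1_general {d k : ℕ} {a : MagneticWeyl.Space d → ℂ} (ha : Measurable a) {C : ℝ}
    (haC : ∀ ξ, ‖a ξ‖ ≤ C * (1 + ‖ξ‖) ^ k) {B : MagneticWeyl.Space d → MagneticWeyl.Space d}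
    (hB : ContDiff ℝ (k + (d + 1) : ℕ) B) {f : MagneticWeyl.Space d → ℂ}
    (hf : ContDiff ℝ (k + (d + 1) : ℕ) f) (hfc : HasCompactSupport f) (x : MagneticWeyl.Space d) :
    MagneticWeyl.OscIntegrable (MagneticWeyl.symbolWeylIntegrand a B f x) ∧
    MagneticWeyl.OscIntegrable (MagneticWeyl.symbolShiftedIntegrand a B f x) ∧
    MagneticWeyl.oscIntegral (MagneticWeyl.symbolWeylIntegrand a B f x) =
      MagneticWeyl.oscIntegral (MagneticWeyl.symbolShiftedIntegrand a B f x) := by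
  obtain ⟨I, hw, hs⟩ := MagneticWeyl.exists_hasOscIntegral_symbolIntegrands ha haC hB hf hfc x
  exact ⟨⟨I, hw⟩, ⟨I, hs⟩, hw.oscIntegral_eq.trans hs.oscIntegral_eq.symm⟩

theorem proposition2p1 {d : ℕ} (m : ℝ) (hm : 0 ≤ m)
    (A : MagneticWeyl.Space d → MagneticWeyl.Space d) (hA : ContDiff ℝ ∞ A)
    (τ : ℝ) (hτ : 0 ≤ τ)
    (hAτ : ∀ (n : ℕ) (i : Fin n → Fin d), ∃ C : ℝ, ∀ x : MagneticWeyl.Space d,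
      ‖MagneticWeyl.partialDeriv i A x‖ ≤ C * (Real.sqrt (1 + ‖x‖ ^ 2)) ^ τ)
    (f : MagneticWeyl.Space d → ℂ) (hf : ContDiff ℝ ∞ f) (hfc : HasCompactSupport f)
    (x : MagneticWeyl.Space d) :
    MagneticWeyl.OscIntegrable (MagneticWeyl.weylIntegrand m A f x) ∧
    MagneticWeyl.OscIntegrable (MagneticWeyl.shiftedIntegrand m A f x) ∧
    MagneticWeyl.weylOperator m A f x =
      (1 / (2 * (Real.pi : ℂ)) ^ d) *
        MagneticWeyl.oscIntegral (MagneticWeyl.shiftedIntegrand m A f x) := by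
  have hB : ContDiff ℝ ∞ fun y => A ((1 / 2 : ℝ) • (x + y)) :=
    hA.comp ((contDiff_const.add contDiff_id).const_smul _)
  obtain ⟨hw, hs, heq⟩ := proposition2p1_general (k := 1) (by fun_prop)
    (fun ξ => (MagneticWeyl.norm_sqrt_norm_sq_add_sq_le m ξ).trans_eq (by rw [pow_one]))
    (hB.of_le (mod_cast le_top)) (hf.of_le (mod_cast le_top)) hfc x
  exact ⟨hw, hs, congrArg ((1 / (2 * (Real.pi : ℂ)) ^ d) * ·) heq⟩
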